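/- Let $N \ge 1$ (customers) and $K \ge 0$ (sampling intervals) be integers, and let $b, \epsilon, \Delta t > 0$ be real numbers (adjacency parameter, privacy parameter, sampling period). For $1 \le i \le N$ and $1 \le k \le K$ let $w_k^i$ be real random variables on a common probability space (the noise added to the demand of customer $i$ at time $k$), such that the noise trajectories $(w_k^i)_{1\le k\le K}$, $i = 1,\dots,N$, of different customers are independent. Let $\tilde E^i = \Delta t \sum_{k=1}^K w_k^i$ be the billing error of customer $i$, and assume that every $\tilde E^i$ is Gaussian with mean $0$ and variance $2K\frac{b^2}{\epsilon^2}(\Delta t)^2$. Then $\max_{1\le i\le N}\tilde E^i$ is square-integrable, and $$0.478\,\frac{b}{\epsilon}\,\Delta t\,\sqrt{K}\,\sqrt{\log N}\;\le\;\mathbb{E}\Big[\max_{1\le i\le N}\tilde E^i\Big]\;\le\;2\,\frac{b}{\epsilon}\,\Delta t\,\sqrt{K}\,\sqrt{\log N},$$ $$\operatorname{var}\Big[\max_{1\le i\le N}\tilde E^i\Big]\;\le\;8K\,\frac{b^2}{\epsilon^2}\,(\Delta t)^2,$$ where $\log$ is the natural logarithm. -/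

import Mathlib

open MeasureTheory ProbabilityTheory

/-- The billing error (error in the estimated energy consumption) of customer `i` over `K` sampling
intervals of length `Δt`, when `w i k` is the noise added to the power demand of customer `i` in the
`k`-th interval: the random variable `Δt * ∑ₖ w i k`. -/
noncomputable def billingError {Ω : Type*} {N K : ℕ} (Δt : ℝ) (w : Fin N → Fin K → Ω → ℝ)
    (i : Fin N) (ω : Ω) : ℝ :=
  Δt * ∑ k : Fin K, w i k ω

/-- The maximum of the billing errors over the `N ≥ 1` customers. -/
noncomputable def maxBillingError {Ω : Type*} {N K : ℕ} [NeZero N] (Δt : ℝ)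
    (w : Fin N → Fin K → Ω → ℝ) (ω : Ω) : ℝ :=
  Finset.univ.sup' Finset.univ_nonempty fun i : Fin N => billingError Δt w i ω

-- For `K > 0`, dividing by `σ = √2 (b/ε) Δt √K` reduces everything to the maximum `M` of `N`
-- independent standard normals, with density `ρ = N Φ^(N-1) φ`.
--
-- Variance: since `φ/Φ` is nonincreasing, the score `s = -(log ρ)'` grows at least as fast as the
-- identity. Integration by parts then gives `Var M ≤ ∫ (x - m) s ρ = 1`
-- (`integral_sq_sub_mean_mul_maxNormalPDF_le_one`).
--
-- Upper bound: the exponential moment method with parameter `a = E M` gives `a² ≤ log N + a²/2`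
-- (`integral_sup'_stdNormal_le`).
--
-- Lower bound (`le_integral_sup'_stdNormal`): for large `N`, `M` exceeds `√(log N)/2` with
-- probability at least 0.68 and its negative part is negligible. For `2 ≤ N ≤ 16`, the mean `1/√π`
-- of the maximum of two variables suffices.

local notation "φ" => gaussianPDFReal 0 1
local notation "Φ" => cdf (gaussianReal 0 1)

/-! ### The standard normal density and distribution function -/

lemma stdNormalPDF_eq (x : ℝ) : φ x = (√(2 * Real.pi))⁻¹ * Real.exp (-x ^ 2 / 2) := by
  simp [gaussianPDFReal_def]

lemma hasDerivAt_stdNormalPDF (x : ℝ) : HasDerivAt φ (-x * φ x) x := by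
  have h : HasDerivAt (fun y : ℝ => (√(2 * Real.pi))⁻¹ * Real.exp (-y ^ 2 / 2))
      ((√(2 * Real.pi))⁻¹ * (Real.exp (-x ^ 2 / 2) * (-(2 * x) / 2))) x := by
    have h1 : HasDerivAt (fun y : ℝ => -y ^ 2 / 2) (-(2 * x) / 2) x := by
      simpa using ((hasDerivAt_pow 2 x).neg.div_const 2)
    exact h1.exp.const_mul _
  rw [show φ = fun y : ℝ => (√(2 * Real.pi))⁻¹ * Real.exp (-y ^ 2 / 2) from
    funext stdNormalPDF_eq]
  convert! h using 1
  ring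

lemma continuous_stdNormalPDF : Continuous φ :=
  continuous_iff_continuousAt.2 fun x => (hasDerivAt_stdNormalPDF x).continuousAt

lemma stdNormalPDF_pos (x : ℝ) : 0 < φ x := gaussianPDFReal_pos 0 1 x one_ne_zero

lemma stdNormalPDF_le_one (x : ℝ) : φ x ≤ 1 := by
  rw [stdNormalPDF_eq]
  have h1 : 1 ≤ √(2 * Real.pi) := by
    rw [Real.one_le_sqrt]; linarith [Real.pi_gt_three]
  refine mul_le_one₀ (inv_le_one_of_one_le₀ h1) (Real.exp_pos _).le ?_
  rw [Real.exp_le_one_iff]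
  nlinarith [sq_nonneg x]

lemma stdNormalCDF_eq_integral (x : ℝ) : Φ x = ∫ y in Set.Iic x, φ y := by
  rw [cdf_eq_real, measureReal_def, gaussianReal_apply_eq_integral _ one_ne_zero,
    ENNReal.toReal_ofReal]
  exact setIntegral_nonneg measurableSet_Iic fun y _ => gaussianPDFReal_nonneg _ _ _

lemma hasDerivAt_stdNormalCDF (x : ℝ) : HasDerivAt Φ (φ x) x := by
  have hφ := integrable_gaussianPDFReal 0 1
  have h : ∀ y, Φ y = (∫ z in (0 : ℝ)..y, φ z) + Φ 0 := fun y => by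
    rw [stdNormalCDF_eq_integral, stdNormalCDF_eq_integral,
      ← intervalIntegral.integral_Iic_sub_Iic hφ.integrableOn hφ.integrableOn]
    ring
  rw [show (Φ : ℝ → ℝ) = _ from funext h]
  exact (intervalIntegral.integral_hasDerivAt_right hφ.intervalIntegrable
    (continuous_stdNormalPDF.stronglyMeasurableAtFilter _ _)
    continuous_stdNormalPDF.continuousAt).add_const _

lemma continuous_stdNormalCDF : Continuous Φ :=
  continuous_iff_continuousAt.2 fun x => (hasDerivAt_stdNormalCDF x).continuousAt

lemma stdNormalCDF_zero : Φ 0 = 1 / 2 := by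
  have h1 : (gaussianReal 0 1).real (Set.Iic 0) = (gaussianReal 0 1).real (Set.Ioi 0) := by
    have h : (gaussianReal 0 1).map (fun x => -x) = gaussianReal 0 1 := by
      simpa using gaussianReal_map_neg (μ := 0) (v := 1)
    have := nullSingletonClass_gaussianReal (μ := 0) (v := 1) one_ne_zero
    conv_lhs => rw [← h]
    rw [map_measureReal_apply measurable_neg measurableSet_Iic]
    simp only [Set.neg_preimage, Set.neg_Iic, neg_zero]
    exact (measureReal_congr Ioi_ae_eq_Ici).symm
  have h2 : (gaussianReal 0 1).real (Set.Ioi 0) = 1 - (gaussianReal 0 1).real (Set.Iic 0) := by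
    rw [← Set.compl_Iic, probReal_compl_eq_one_sub measurableSet_Iic]
  rw [cdf_eq_real]
  linarith

lemma integrable_pow_mul_stdNormalPDF (k : ℕ) : Integrable fun x : ℝ => x ^ k * φ x := by
  have h := integrable_rpow_mul_exp_neg_mul_sq (b := 1 / 2) (by norm_num) (s := k)
    (by have : (0 : ℝ) ≤ k := k.cast_nonneg
        linarith)
  refine (h.const_mul (√(2 * Real.pi))⁻¹).congr (.of_forall fun x => ?_)
  simp only [stdNormalPDF_eq, Real.rpow_natCast]
  rw [show -(1 / 2) * x ^ 2 = -x ^ 2 / 2 by ring]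
  ring

lemma integrable_pow_mul_stdNormalPDF_mul (k : ℕ) {g : ℝ → ℝ} (hg : Continuous g) {C : ℝ}
    (hC : ∀ x, |g x| ≤ C) : Integrable fun x : ℝ => x ^ k * φ x * g x :=
  (integrable_pow_mul_stdNormalPDF k).mul_bdd hg.aestronglyMeasurable (.of_forall hC)

lemma abs_stdNormalCDF_pow_le (n : ℕ) (x : ℝ) : |Φ x ^ n| ≤ 1 := by
  rw [abs_of_nonneg (pow_nonneg (cdf_nonneg _ _) n)]
  exact pow_le_one₀ (cdf_nonneg _ _) (cdf_le_one _ _)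

lemma stdNormalCDF_pos (x : ℝ) : 0 < Φ x := by
  have h : StrictMono Φ := strictMono_of_hasDerivAt_pos hasDerivAt_stdNormalCDF stdNormalPDF_pos
  exact (cdf_nonneg _ (x - 1)).trans_lt (h (by linarith))

lemma tendsto_stdNormalPDF_atBot : Filter.Tendsto φ Filter.atBot (nhds 0) :=
  tendsto_zero_of_hasDerivAt_of_integrableOn_Iic (a := 0) (fun x _ => hasDerivAt_stdNormalPDF x)
    (by simpa using (integrable_pow_mul_stdNormalPDF 1).neg.integrableOn)
    (integrable_gaussianPDFReal 0 1).integrableOn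

/-- The expression equals the integral of `(x - y) φ y` over `y ≤ x`, because `φ' = -y φ`. -/
lemma mul_stdNormalCDF_add_pdf_nonneg (x : ℝ) : 0 ≤ x * Φ x + φ x := by
  have hint : Integrable fun y : ℝ => -y * φ y := by
    simpa using (integrable_pow_mul_stdNormalPDF 1).neg
  have h := integral_Iic_of_hasDerivAt_of_tendsto' (a := x)
    (fun y _ => hasDerivAt_stdNormalPDF y) hint.integrableOn tendsto_stdNormalPDF_atBot
  rw [sub_zero] at h
  rw [stdNormalCDF_eq_integral, ← h, ← integral_const_mul,
    ← integral_add ((integrable_gaussianPDFReal 0 1).integrableOn.const_mul x) hint.integrableOn]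
  refine setIntegral_nonneg measurableSet_Iic fun y hy => ?_
  have := mul_nonneg (sub_nonneg.2 (Set.mem_Iic.1 hy)) (stdNormalPDF_pos y).le
  linarith

/-- The reversed hazard rate of the standard normal distribution is nonincreasing. -/
lemma antitone_stdNormalPDF_div_cdf : Antitone fun x : ℝ => φ x / Φ x := by
  refine antitone_of_hasDerivAt_nonpos (fun x => (hasDerivAt_stdNormalPDF x).div
    (hasDerivAt_stdNormalCDF x) (stdNormalCDF_pos x).ne') fun x => ?_
  refine div_nonpos_of_nonpos_of_nonneg ?_ (sq_nonneg _)
  -- The numerator of the derivative is `-φ x * (x * Φ x + φ x)`.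
  have := mul_nonneg (stdNormalPDF_pos x).le (mul_stdNormalCDF_add_pdf_nonneg x)
  linarith

/-- Mean value theorem for `Φ` on `[t, t + δ]`, where `φ` is smallest at the right end. -/
lemma mul_stdNormalPDF_le_one_sub_cdf {t δ : ℝ} (ht : 0 ≤ t) (hδ : 0 < δ) :
    δ * φ (t + δ) ≤ 1 - Φ t := by
  obtain ⟨c, ⟨hc1, hc2⟩, hc⟩ := exists_hasDerivAt_eq_slope Φ φ (lt_add_of_pos_right t hδ)
    continuous_stdNormalCDF.continuousOn fun x _ => hasDerivAt_stdNormalCDF x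
  have h1 : φ (t + δ) ≤ φ c := by
    rw [stdNormalPDF_eq, stdNormalPDF_eq]
    gcongr
    linarith
  rw [add_sub_cancel_left, eq_div_iff hδ.ne'] at hc
  nlinarith [cdf_le_one (gaussianReal 0 1) (t + δ)]

/-! ### The density of the maximum of `n + 1` independent standard normal variables -/

/-- The density of the maximum of `n + 1` independent standard normal variables. -/
noncomputable def maxNormalPDF (n : ℕ) (x : ℝ) : ℝ := (n + 1) * Φ x ^ n * φ x

lemma maxNormalPDF_nonneg (n : ℕ) (x : ℝ) : 0 ≤ maxNormalPDF n x :=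
  mul_nonneg (mul_nonneg (by positivity) (pow_nonneg (cdf_nonneg _ _) _)) (stdNormalPDF_pos x).le

lemma continuous_maxNormalPDF (n : ℕ) : Continuous (maxNormalPDF n) :=
  (continuous_const.mul (continuous_stdNormalCDF.pow n)).mul continuous_stdNormalPDF

lemma hasDerivAt_stdNormalCDF_pow (n : ℕ) (x : ℝ) :
    HasDerivAt (fun y => Φ y ^ (n + 1)) (maxNormalPDF n x) x := by
  convert! (hasDerivAt_stdNormalCDF x).pow (n + 1) using 1
  simp [maxNormalPDF]

lemma integrable_pow_mul_maxNormalPDF (n k : ℕ) :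
    Integrable fun x : ℝ => x ^ k * maxNormalPDF n x := by
  refine ((integrable_pow_mul_stdNormalPDF_mul k (continuous_stdNormalCDF.pow n)
    (abs_stdNormalCDF_pow_le n)).const_mul (n + 1 : ℝ)).congr (.of_forall fun x => ?_)
  simp only [maxNormalPDF, Pi.pow_apply]
  ring

lemma integrable_maxNormalPDF (n : ℕ) : Integrable (maxNormalPDF n) := by
  simpa using integrable_pow_mul_maxNormalPDF n 0

lemma setIntegral_Iic_maxNormalPDF (n : ℕ) (x : ℝ) :
    ∫ y in Set.Iic x, maxNormalPDF n y = Φ x ^ (n + 1) := by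
  have h0 : Filter.Tendsto (fun y => Φ y ^ (n + 1)) Filter.atBot (nhds 0) := by
    simpa using (tendsto_cdf_atBot (gaussianReal 0 1)).pow (n + 1)
  simpa using integral_Iic_of_hasDerivAt_of_tendsto' (a := x)
    (fun y _ => hasDerivAt_stdNormalCDF_pow n y) (integrable_maxNormalPDF n).integrableOn h0

lemma integral_maxNormalPDF (n : ℕ) : ∫ y, maxNormalPDF n y = 1 := by
  have h0 : Filter.Tendsto (fun y => Φ y ^ (n + 1)) Filter.atBot (nhds 0) := by
    simpa using (tendsto_cdf_atBot (gaussianReal 0 1)).pow (n + 1)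
  have h1 : Filter.Tendsto (fun y => Φ y ^ (n + 1)) Filter.atTop (nhds 1) := by
    simpa using (tendsto_cdf_atTop (gaussianReal 0 1)).pow (n + 1)
  simpa using integral_of_hasDerivAt_of_tendsto (fun y => hasDerivAt_stdNormalCDF_pow n y)
    (integrable_maxNormalPDF n) h0 h1

/-! ### Score of the maximum, integration by parts and the variance bound -/

lemma hasDerivAt_maxNormalPDF (n : ℕ) (x : ℝ) :
    HasDerivAt (maxNormalPDF n)
      ((n + 1) * (n * Φ x ^ (n - 1) * φ x) * φ x + (n + 1) * Φ x ^ n * (-x * φ x)) x :=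
  (((hasDerivAt_stdNormalCDF x).pow n).const_mul _).mul (hasDerivAt_stdNormalPDF x)

/-- The logarithmic derivative of the density of the maximum, with the opposite sign. -/
noncomputable def maxNormalScore (n : ℕ) (x : ℝ) : ℝ := x - n * (φ x / Φ x)

/-- Multiplying by the density clears `Φ` from the denominator, leaving terms that are visibly
integrable. At `n = 0` the truncated `n - 1` is harmless thanks to the factor `n`. -/
lemma maxNormalScore_mul_maxNormalPDF (n : ℕ) (x : ℝ) :
    maxNormalScore n x * maxNormalPDF n x =
      x * maxNormalPDF n x - (n + 1) * n * (φ x * (Φ x ^ (n - 1) * φ x)) := by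
  have := (stdNormalCDF_pos x).ne'
  cases n with
  | zero => simp [maxNormalScore]
  | succ n =>
    simp only [maxNormalScore, maxNormalPDF, Nat.add_sub_cancel]
    field_simp
    ring

lemma hasDerivAt_maxNormalPDF_score (n : ℕ) (x : ℝ) :
    HasDerivAt (maxNormalPDF n) (-(maxNormalScore n x * maxNormalPDF n x)) x := by
  convert! hasDerivAt_maxNormalPDF n x using 1
  rw [maxNormalScore_mul_maxNormalPDF, maxNormalPDF]
  ring

lemma integrable_pow_mul_score_mul_maxNormalPDF (n k : ℕ) :
    Integrable fun x : ℝ => x ^ k * (maxNormalScore n x * maxNormalPDF n x) := by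
  have hb : ∀ x, |Φ x ^ (n - 1) * φ x| ≤ 1 := fun x => by
    rw [abs_mul, abs_of_pos (stdNormalPDF_pos x)]
    exact mul_le_one₀ (abs_stdNormalCDF_pow_le _ x) (stdNormalPDF_pos x).le (stdNormalPDF_le_one x)
  refine ((integrable_pow_mul_maxNormalPDF n (k + 1)).sub
    ((integrable_pow_mul_stdNormalPDF_mul k ((continuous_stdNormalCDF.pow (n - 1)).mul
      continuous_stdNormalPDF) hb).const_mul ((n + 1) * n : ℝ))).congr (.of_forall fun x => ?_)
  simp only [Pi.sub_apply, maxNormalScore_mul_maxNormalPDF, Pi.mul_apply, Pi.pow_apply]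
  ring

lemma integral_score_mul_maxNormalPDF (n : ℕ) :
    ∫ x, maxNormalScore n x * maxNormalPDF n x = 0 := by
  have h := integral_eq_zero_of_hasDerivAt_of_integrable (hasDerivAt_maxNormalPDF_score n)
    (by simpa using (integrable_pow_mul_score_mul_maxNormalPDF n 0).neg)
    (integrable_maxNormalPDF n)
  rwa [integral_neg, neg_eq_zero] at h

/-- The derivative `ρ - x s ρ` of the integrable function `x ρ` has integral zero. -/
lemma integral_mul_score_mul_maxNormalPDF (n : ℕ) :
    ∫ x, x * (maxNormalScore n x * maxNormalPDF n x) = 1 := by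
  have hi1 := integrable_pow_mul_score_mul_maxNormalPDF n 1
  have hi2 := integrable_pow_mul_maxNormalPDF n 1
  simp only [pow_one] at hi1 hi2
  have h := integral_eq_zero_of_hasDerivAt_of_integrable
    (fun x => (hasDerivAt_id x).mul (hasDerivAt_maxNormalPDF_score n x))
    (f' := fun x => 1 * maxNormalPDF n x + x * -(maxNormalScore n x * maxNormalPDF n x))
    (((integrable_maxNormalPDF n).sub hi1).congr (.of_forall fun x => by
      simp only [Pi.sub_apply]; ring)) hi2
  have h2 := integral_sub (integrable_maxNormalPDF n) hi1
  simp only [one_mul, mul_neg, ← sub_eq_add_neg] at h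
  rw [h, integral_maxNormalPDF] at h2
  linarith

lemma sq_sub_le_score_sub_mul (n : ℕ) (m x : ℝ) :
    (x - m) ^ 2 ≤ (x - m) * (maxNormalScore n x - maxNormalScore n m) := by
  have h : (x - m) * (φ x / Φ x - φ m / Φ m) ≤ 0 := by
    rcases le_total m x with h | h
    · exact mul_nonpos_of_nonneg_of_nonpos (sub_nonneg.2 h)
        (sub_nonpos.2 (antitone_stdNormalPDF_div_cdf h))
    · exact mul_nonpos_of_nonpos_of_nonneg (sub_nonpos.2 h)
        (sub_nonneg.2 (antitone_stdNormalPDF_div_cdf h))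
  have := mul_nonpos_of_nonneg_of_nonpos (n.cast_nonneg (α := ℝ)) h
  simp only [maxNormalScore]
  linarith

/-- The density of the maximum is more log-concave than the standard normal density, so its
variance is at most `1`. -/
lemma integral_sq_sub_mean_mul_maxNormalPDF_le_one (n : ℕ) {m : ℝ}
    (hm : ∫ x, x * maxNormalPDF n x = m) :
    ∫ x, (x - m) ^ 2 * maxNormalPDF n x ≤ 1 := by
  have i0 := integrable_maxNormalPDF n
  have i1 := integrable_pow_mul_maxNormalPDF n 1
  have i2 := integrable_pow_mul_maxNormalPDF n 2
  have s0 := integrable_pow_mul_score_mul_maxNormalPDF n 0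
  have s1 := integrable_pow_mul_score_mul_maxNormalPDF n 1
  simp only [pow_one, pow_zero, one_mul] at i1 s0 s1
  -- Subtracting the constant `c` from the score costs nothing: `x - m` has mean zero under the
  -- density.
  set c := maxNormalScore n m
  have hsplit : ∀ x, (x - m) * (maxNormalScore n x - c) * maxNormalPDF n x =
      (x * (maxNormalScore n x * maxNormalPDF n x) - m * (maxNormalScore n x * maxNormalPDF n x))
        - (c * (x * maxNormalPDF n x) - c * m * maxNormalPDF n x) := fun x => by ring
  calc ∫ x, (x - m) ^ 2 * maxNormalPDF n x
      ≤ ∫ x, (x - m) * (maxNormalScore n x - c) * maxNormalPDF n x := by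
        refine integral_mono ?_ ?_ fun x =>
          mul_le_mul_of_nonneg_right (sq_sub_le_score_sub_mul n m x) (maxNormalPDF_nonneg n x)
        · refine ((i2.sub (i1.const_mul (2 * m))).add (i0.const_mul (m ^ 2))).congr
            (.of_forall fun x => ?_)
          simp only [Pi.sub_apply, Pi.add_apply]
          ring
        · simp only [hsplit]
          exact (s1.sub (s0.const_mul m)).sub ((i1.const_mul c).sub (i0.const_mul (c * m)))
    _ = 1 := by
        have hA : Integrable fun x => x * (maxNormalScore n x * maxNormalPDF n x)
            - m * (maxNormalScore n x * maxNormalPDF n x) := s1.sub (s0.const_mul m)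
        have hB : Integrable fun x => c * (x * maxNormalPDF n x) - c * m * maxNormalPDF n x :=
          (i1.const_mul c).sub (i0.const_mul (c * m))
        simp only [hsplit]
        rw [integral_sub hA hB,
          integral_sub s1 (s0.const_mul m), integral_sub (i1.const_mul c) (i0.const_mul (c * m)),
          integral_const_mul, integral_const_mul, integral_const_mul,
          integral_score_mul_maxNormalPDF, integral_mul_score_mul_maxNormalPDF,
          integral_maxNormalPDF, hm]
        ring

/-! ### Lower bounds for the mean of the maximum -/

/-- For `n = 1` the vanishing of the mean score says that the mean is `2 ∫ φ²`, a Gaussian integral.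
-/
lemma integral_mul_maxNormalPDF_one : ∫ x, x * maxNormalPDF 1 x = (√Real.pi)⁻¹ := by
  have i1 := integrable_pow_mul_maxNormalPDF 1 1
  simp only [pow_one] at i1
  have hsq : ∀ x, φ x * φ x = (2 * Real.pi)⁻¹ * Real.exp (-1 * x ^ 2) := fun x => by
    rw [stdNormalPDF_eq, mul_mul_mul_comm, ← mul_inv, Real.mul_self_sqrt (by positivity),
      ← Real.exp_add]
    ring_nf
  have hi : Integrable fun x => φ x * φ x := by
    simp only [hsq]
    exact (integrable_exp_neg_mul_sq one_pos).const_mul _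
  have h := integral_score_mul_maxNormalPDF 1
  simp only [maxNormalScore_mul_maxNormalPDF, Nat.sub_self, pow_zero, one_mul, Nat.cast_one,
    mul_one] at h
  rw [integral_sub i1 (hi.const_mul _), sub_eq_zero] at h
  rw [h, integral_const_mul]
  simp only [hsq]
  rw [integral_const_mul, integral_gaussian, div_one]
  have hp : 0 < √Real.pi := Real.sqrt_pos.2 Real.pi_pos
  rw [mul_inv, ← Real.mul_self_sqrt Real.pi_pos.le, Real.sqrt_mul_self hp.le]
  field_simp
  norm_num

lemma integral_abs_mul_stdNormalPDF_le_one : ∫ x, |x| * φ x ≤ 1 := by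
  have i0 := integrable_gaussianPDFReal 0 1
  have i1 := (integrable_pow_mul_stdNormalPDF 1).norm
  have i2 := integrable_pow_mul_stdNormalPDF 2
  have e2 : ∫ x, x ^ 2 * φ x = 1 := by
    have h := variance_eq_integral (μ := gaussianReal 0 1) (X := fun x => x) aemeasurable_id'
    rw [variance_fun_id_gaussianReal, integral_id_gaussianReal,
      integral_gaussianReal_eq_integral_smul one_ne_zero] at h
    simpa [mul_comm] using h.symm
  calc ∫ x, |x| * φ x ≤ ∫ x, (1 / 2) * (φ x + x ^ 2 * φ x) := by
        refine integral_mono ?_ ((i0.add i2).const_mul _) fun x => ?_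
        · simpa [abs_of_pos (stdNormalPDF_pos _)] using i1
        · have := stdNormalPDF_pos x
          have h : |x| ≤ (1 / 2) * (1 + x ^ 2) := by
            rw [← sq_abs]; nlinarith [sq_nonneg (|x| - 1)]
          calc |x| * φ x ≤ (1 / 2) * (1 + x ^ 2) * φ x := by gcongr
            _ = _ := by ring
    _ = 1 := by
        rw [integral_const_mul, integral_add i0 i2, e2,
          integral_gaussianPDFReal_eq_one _ one_ne_zero]
        norm_num

/-- A lower bound for the mean of the maximum: the part of the density left of the origin
contributes little. -/
lemma le_integral_mul_maxNormalPDF (n : ℕ) (t : ℝ) :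
    t * (1 - Φ t ^ (n + 1)) - (n + 1) * (1 / 2) ^ n ≤ ∫ x, x * maxNormalPDF n x := by
  have i1 := integrable_pow_mul_maxNormalPDF n 1
  simp only [pow_one] at i1
  have a1 : Integrable fun x => |x| * φ x := by
    simpa [abs_of_pos (stdNormalPDF_pos _)] using (integrable_pow_mul_stdNormalPDF 1).norm
  have hmass : ∫ x in Set.Ioi t, maxNormalPDF n x = 1 - Φ t ^ (n + 1) := by
    have := integral_add_compl (measurableSet_Iic (a := t)) (integrable_maxNormalPDF n)
    rw [integral_maxNormalPDF, setIntegral_Iic_maxNormalPDF, Set.compl_Iic] at this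
    linarith
  -- On the negative axis `Φ ≤ 1/2` makes the density at most `(n + 1) (1/2)^n φ`.
  have hpt : ∀ x, (Set.Ioi t).indicator (fun x => t * maxNormalPDF n x) x
      - (n + 1) * (1 / 2) ^ n * (|x| * φ x) ≤ x * maxNormalPDF n x := fun x => by
    have hρ := maxNormalPDF_nonneg n x
    have hφ := stdNormalPDF_pos x
    have hneg : 0 ≤ (n + 1) * (1 / 2) ^ n * (|x| * φ x) := by positivity
    by_cases hx : x ∈ Set.Ioi t
    · rw [Set.indicator_of_mem hx]
      have := mul_le_mul_of_nonneg_right (Set.mem_Ioi.1 hx).le hρ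
      linarith
    · rw [Set.indicator_of_notMem hx]
      rcases le_total 0 x with h0 | h0
      · have := mul_nonneg h0 hρ
        linarith
      · have h1 : Φ x ^ n ≤ (1 / 2) ^ n := by
          rw [← stdNormalCDF_zero]
          exact pow_le_pow_left₀ (cdf_nonneg _ _) (monotone_cdf _ h0) n
        have h2 : |x| * maxNormalPDF n x ≤ (n + 1) * (1 / 2) ^ n * (|x| * φ x) := by
          calc |x| * maxNormalPDF n x = (n + 1) * Φ x ^ n * (|x| * φ x) := by
                rw [maxNormalPDF]; ring
            _ ≤ _ := by gcongr
        rw [abs_of_nonpos h0] at h2 ⊢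
        linarith
  have hint : Integrable ((Set.Ioi t).indicator fun x => t * maxNormalPDF n x) :=
    ((integrable_maxNormalPDF n).const_mul t).indicator measurableSet_Ioi
  have h := integral_mono (hint.sub (a1.const_mul ((n + 1) * (1 / 2) ^ n))) i1 hpt
  simp only [Pi.sub_apply] at h
  rw [integral_sub hint (a1.const_mul _), integral_indicator measurableSet_Ioi,
    integral_const_mul, integral_const_mul, hmass] at h
  have h3 : (n + 1 : ℝ) * (1 / 2) ^ n * ∫ x, |x| * φ x ≤ (n + 1) * (1 / 2) ^ n * 1 := by
    gcongr
    exact integral_abs_mul_stdNormalPDF_le_one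
  linarith

lemma add_one_mul_half_pow_le {n : ℕ} (hn : 15 ≤ n) : (n + 1 : ℝ) * (1 / 2) ^ n ≤ 0.001 := by
  induction n, hn using Nat.le_induction with
  | base => norm_num
  | succ n _ ih =>
    refine le_trans ?_ ih
    rw [pow_succ]
    push_cast
    have h : (0 : ℝ) < (1 / 2) ^ n := by positivity
    have hn : (0 : ℝ) ≤ n := n.cast_nonneg
    nlinarith [mul_nonneg hn h.le]

lemma log_sixteen : Real.log 16 = 4 * Real.log 2 := by
  rw [show (16 : ℝ) = 2 ^ 4 by norm_num, Real.log_pow]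
  norm_num

/-- With `p = 1 - Φ t`, `(1 - p)^N ≤ exp (-N p)`; the tail estimate with `δ = 0.7` gives `N p ≥
1.25`. -/
lemma stdNormalCDF_pow_le {N : ℕ} (hN : 16 ≤ N) :
    Φ (√(Real.log N) / 2) ^ N ≤ 0.32 := by
  have hN' : (16 : ℝ) ≤ N := by exact_mod_cast hN
  have hN0 : (0 : ℝ) < N := by linarith
  set L := Real.log N with hL
  have hL16 : 4 * Real.log 2 ≤ L := by
    rw [← log_sixteen]; exact Real.log_le_log (by norm_num) hN'
  have hL0 : 0 ≤ L := by linarith [Real.log_two_gt_d9]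
  set t := √L / 2 with ht
  have ht0 : 0 ≤ t := by positivity
  have htsq : t ^ 2 = L / 4 := by rw [ht, div_pow, Real.sq_sqrt hL0]; norm_num
  -- `(t + 0.7)² / 2 ≤ t² + 0.49 ≤ L/4 + 1/2`.
  have hφ : (√(2 * Real.pi))⁻¹ * Real.exp (-(L / 4) - 1 / 2) ≤ φ (t + 0.7) := by
    rw [stdNormalPDF_eq]
    gcongr
    nlinarith [sq_nonneg (t - 0.7)]
  have hsqrt : √(2 * Real.pi) ≤ 2.51 := by
    rw [Real.sqrt_le_left (by norm_num)]
    linarith [Real.pi_lt_d2]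
  have hsqrt0 : 0 < √(2 * Real.pi) := by positivity
  have hhalf : Real.exp (1 / 2) ≤ 1.65 := by
    refine le_of_sq_le_sq ?_ (by norm_num)
    rw [← Real.exp_nat_mul]
    norm_num
    linarith [Real.exp_one_lt_d9]
  -- `exp (3L/4) = N^(3/4) ≥ 16^(3/4) = 8`.
  have h8 : 8 ≤ Real.exp (3 * L / 4) := by
    calc (8 : ℝ) = Real.exp (3 * Real.log 2) := by
          rw [show (3 : ℝ) * Real.log 2 = ((3 : ℕ) : ℝ) * Real.log 2 by norm_num, Real.exp_nat_mul,
            Real.exp_log (by norm_num)]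
          norm_num
      _ ≤ _ := Real.exp_le_exp.2 (by linarith)
  have hexp : Real.exp (-(L / 4) - 1 / 2) * N = Real.exp (3 * L / 4) / Real.exp (1 / 2) := by
    rw [← Real.exp_sub]
    nth_rw 1 [← Real.exp_log hN0]
    rw [← Real.exp_add, ← hL]
    ring_nf
  have hNp : 1.25 ≤ N * (1 - Φ t) := by
    calc (1.25 : ℝ) ≤ 0.7 * ((2.51)⁻¹ * (8 / 1.65)) := by norm_num
      _ ≤ 0.7 * ((√(2 * Real.pi))⁻¹ * (Real.exp (3 * L / 4) / Real.exp (1 / 2))) := by gcongr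
      _ = N * (0.7 * ((√(2 * Real.pi))⁻¹ * Real.exp (-(L / 4) - 1 / 2))) := by
          rw [← hexp]; ring
      _ ≤ N * (0.7 * φ (t + 0.7)) := by gcongr
      _ ≤ N * (1 - Φ t) := by
          gcongr
          exact mul_stdNormalPDF_le_one_sub_cdf ht0 (by norm_num)
  calc Φ t ^ N ≤ Real.exp (-(1 - Φ t)) ^ N := by
        refine pow_le_pow_left₀ (cdf_nonneg _ _) ?_ N
        have := Real.add_one_le_exp (-(1 - Φ t))
        linarith
    _ = Real.exp (-(N * (1 - Φ t))) := by rw [← Real.exp_nat_mul]; ring_nf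
    _ ≤ Real.exp (-1.25) := Real.exp_le_exp.2 (by linarith)
    _ ≤ 0.32 := by
        rw [Real.exp_neg, inv_le_comm₀ (Real.exp_pos _) (by norm_num),
          show (1.25 : ℝ) = 1 + 0.25 by norm_num, Real.exp_add]
        have h1 := Real.exp_one_gt_d9
        have h2 := Real.add_one_le_exp (0.25 : ℝ)
        nlinarith

/-- Here `(1 - 0.32)/2 = 0.34`; the surplus `0.0019 √(log N)` absorbs the error 0.001, as `√(log N)
≥ 1`. -/
lemma sqrt_log_le_integral_mul_maxNormalPDF {n : ℕ} (hn : 15 ≤ n) :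
    0.3381 * √(Real.log (n + 1 : ℕ)) ≤ ∫ x, x * maxNormalPDF n x := by
  refine le_trans ?_ (le_integral_mul_maxNormalPDF n (√(Real.log (n + 1 : ℕ)) / 2))
  have h1 := stdNormalCDF_pow_le (N := n + 1) (by omega)
  have h2 := add_one_mul_half_pow_le hn
  have h3 : 1 ≤ √(Real.log (n + 1 : ℕ)) := by
    rw [Real.one_le_sqrt]
    have : Real.log 16 ≤ Real.log (n + 1 : ℕ) :=
      Real.log_le_log (by norm_num) (by exact_mod_cast (by omega : 16 ≤ n + 1))
    rw [log_sixteen] at this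
    linarith [Real.log_two_gt_d9]
  set s := √(Real.log (n + 1 : ℕ))
  have h4 := mul_le_mul_of_nonneg_left h1 (by linarith : 0 ≤ s / 2)
  linarith

lemma sqrt_log_le_inv_sqrt_pi {N : ℕ} (hN0 : 0 < N) (hN : N ≤ 16) :
    0.3381 * √(Real.log N) ≤ (√Real.pi)⁻¹ := by
  have hL : Real.log N ≤ 4 * Real.log 2 := by
    rw [← log_sixteen]
    exact Real.log_le_log (by exact_mod_cast hN0) (by exact_mod_cast hN)
  have h1 : √(Real.log N) ≤ 1.66511 := by
    rw [Real.sqrt_le_left (by norm_num)]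
    linarith [Real.log_two_lt_d9]
  have h2 : √Real.pi ≤ 1.77246 := by
    rw [Real.sqrt_le_left (by norm_num)]
    linarith [Real.pi_lt_d4]
  calc 0.3381 * √(Real.log N) ≤ 0.3381 * 1.66511 := by gcongr
    _ ≤ (1.77246)⁻¹ := by norm_num
    _ ≤ _ := by gcongr

/-! ### The maximum of independent standard normal variables -/

lemma memLp_of_hasLaw_gaussianReal {Ω : Type*} [MeasurableSpace Ω] {μ : Measure Ω} {X : Ω → ℝ} {m : ℝ}
    {v : NNReal} (hX : HasLaw X (gaussianReal m v) μ) (p : NNReal) : MemLp X p μ := by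
  have h := memLp_id_gaussianReal (μ := m) (v := v) p
  rw [← hX.map_eq] at h
  exact (memLp_map_measure_iff aestronglyMeasurable_id hX.aemeasurable).1 h

section Maximum

variable {Ω ι : Type*} [MeasurableSpace Ω] {μ : Measure Ω}
  [Fintype ι] [Nonempty ι] {Y : ι → Ω → ℝ}

lemma aemeasurable_sup'_univ (hY : ∀ i, AEMeasurable (Y i) μ) :
    AEMeasurable (fun ω => Finset.univ.sup' Finset.univ_nonempty fun i => Y i ω) μ := by
  have h : AEMeasurable (Finset.univ.sup' Finset.univ_nonempty Y) μ :=
    Finset.sup'_induction (p := fun f => AEMeasurable f μ) _ _ (fun _ ha _ hb => ha.sup hb)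
      fun i _ => hY i
  convert! h using 1
  ext ω
  simp [Finset.sup'_apply]

lemma memLp_sup'_univ {p : ENNReal} (hY : ∀ i, MemLp (Y i) p μ) :
    MemLp (fun ω => Finset.univ.sup' Finset.univ_nonempty fun i => Y i ω) p μ := by
  have h : MemLp (Finset.univ.sup' Finset.univ_nonempty Y) p μ :=
    Finset.sup'_induction (p := fun f => MemLp f p μ) _ _ (fun _ ha _ hb => ha.sup hb)
      fun i _ => hY i
  convert! h using 1
  ext ω
  simp [Finset.sup'_apply]

lemma integrable_sup'_stdNormal (hlaw : ∀ i, HasLaw (Y i) (gaussianReal 0 1) μ) :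
    Integrable (fun ω => Finset.univ.sup' Finset.univ_nonempty fun i => Y i ω) μ :=
  memLp_one_iff_integrable.1
    (memLp_sup'_univ fun i => by exact_mod_cast memLp_of_hasLaw_gaussianReal (hlaw i) 1)

variable [IsProbabilityMeasure μ]

/-- The law of the maximum of `n + 1` independent standard normal variables. -/
lemma hasLaw_sup'_stdNormal (hlaw : ∀ i, HasLaw (Y i) (gaussianReal 0 1) μ)
    (hindep : iIndepFun Y μ) {n : ℕ} (hn : Fintype.card ι = n + 1) :
    HasLaw (fun ω => Finset.univ.sup' Finset.univ_nonempty fun i => Y i ω)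
      (volume.withDensity fun x => ENNReal.ofReal (maxNormalPDF n x)) μ := by
  have hM := aemeasurable_sup'_univ fun i => (hlaw i).aemeasurable
  refine ⟨hM, ?_⟩
  have := Measure.isProbabilityMeasure_map hM
  refine Measure.ext_of_Iic _ _ fun t => ?_
  rw [Measure.map_apply_of_aemeasurable hM measurableSet_Iic,
    withDensity_apply _ measurableSet_Iic,
    ← ofReal_integral_eq_lintegral_ofReal (integrable_maxNormalPDF n).integrableOn
      (.of_forall fun x => maxNormalPDF_nonneg n x), setIntegral_Iic_maxNormalPDF,
    show (fun ω => Finset.univ.sup' Finset.univ_nonempty fun i => Y i ω) ⁻¹' Set.Iic t =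
      ⋂ i, Y i ⁻¹' Set.Iic t by ext ω; simp,
    hindep.meas_iInter fun i => ⟨_, measurableSet_Iic, rfl⟩]
  have h : ∀ i, μ (Y i ⁻¹' Set.Iic t) = ENNReal.ofReal (Φ t) := fun i => by
    rw [ofReal_cdf, ← (hlaw i).map_eq,
      Measure.map_apply_of_aemeasurable (hlaw i).aemeasurable measurableSet_Iic]
  simp only [h, Finset.prod_const, Finset.card_univ, hn]
  rw [ENNReal.ofReal_pow (cdf_nonneg _ _)]

lemma integral_comp_sup'_stdNormal (hlaw : ∀ i, HasLaw (Y i) (gaussianReal 0 1) μ)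
    (hindep : iIndepFun Y μ) {n : ℕ} (hn : Fintype.card ι = n + 1) {f : ℝ → ℝ}
    (hf : Continuous f) :
    ∫ ω, f (Finset.univ.sup' Finset.univ_nonempty fun i => Y i ω) ∂μ =
      ∫ x, f x * maxNormalPDF n x := by
  have h := (hasLaw_sup'_stdNormal hlaw hindep hn).integral_comp (f := f) hf.aestronglyMeasurable
  rw [integral_withDensity_eq_integral_toReal_smul
    (continuous_maxNormalPDF n).measurable.ennreal_ofReal (by simp)] at h
  simpa [Function.comp_def, ENNReal.toReal_ofReal (maxNormalPDF_nonneg n _), mul_comm] using h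

lemma variance_sup'_stdNormal_le_one (hlaw : ∀ i, HasLaw (Y i) (gaussianReal 0 1) μ)
    (hindep : iIndepFun Y μ) :
    variance (fun ω => Finset.univ.sup' Finset.univ_nonempty fun i => Y i ω) μ ≤ 1 := by
  obtain ⟨n, hn⟩ := Nat.exists_eq_succ_of_ne_zero (Fintype.card_ne_zero (α := ι))
  rw [variance_eq_integral (aemeasurable_sup'_univ fun i => (hlaw i).aemeasurable)]
  set m := ∫ ω, Finset.univ.sup' Finset.univ_nonempty (fun i => Y i ω) ∂μ with hm
  rw [integral_comp_sup'_stdNormal hlaw hindep hn (f := fun x => (x - m) ^ 2) (by fun_prop)]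
  refine integral_sq_sub_mean_mul_maxNormalPDF_le_one n ?_
  exact (integral_comp_sup'_stdNormal hlaw hindep hn continuous_id).symm

/-- Upper bound for the mean of the maximum; independence is not needed. -/
lemma integral_sup'_stdNormal_le (hlaw : ∀ i, HasLaw (Y i) (gaussianReal 0 1) μ) :
    ∫ ω, Finset.univ.sup' Finset.univ_nonempty (fun i => Y i ω) ∂μ ≤
      √2 * √(Real.log (Fintype.card ι)) := by
  set M : Ω → ℝ := fun ω => Finset.univ.sup' Finset.univ_nonempty fun i => Y i ω
  have hMint : Integrable M μ := integrable_sup'_stdNormal hlaw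
  set a := ∫ ω, M ω ∂μ with ha
  set N : ℝ := (Fintype.card ι : ℝ) with hN
  have hN0 : 0 < N := Nat.cast_pos.2 Fintype.card_pos
  set A := N * Real.exp (a ^ 2 / 2) with hA
  have hA0 : 0 < A := by positivity
  have hexp_int : ∀ i, Integrable (fun ω => Real.exp (a * Y i ω)) μ := fun i => by
    have h := integrable_exp_mul_gaussianReal (μ := 0) (v := 1) a
    rw [← (hlaw i).map_eq] at h
    exact h.comp_aemeasurable (hlaw i).aemeasurable
  have hexp : ∀ i, ∫ ω, Real.exp (a * Y i ω) ∂μ = Real.exp (a ^ 2 / 2) := fun i => by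
    simpa [mgf] using mgf_gaussianReal (hlaw i).map_eq a
  have hsum_int : Integrable (fun ω => ∑ i, Real.exp (a * Y i ω)) μ :=
    integrable_finsetSum _ fun i _ => hexp_int i
  have hsum : ∫ ω, ∑ i, Real.exp (a * Y i ω) ∂μ = A := by
    rw [integral_finsetSum _ fun i _ => hexp_int i]
    simp [hexp, hA, hN]
  -- Tangent line of the logarithm at `A`, the mean of the sum: a pointwise form of Jensen's
  -- inequality.
  have hpt : ∀ ω, a * M ω ≤ (Real.log A - 1) + A⁻¹ * ∑ i, Real.exp (a * Y i ω) := fun ω => by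
    obtain ⟨i, -, hi⟩ := Finset.exists_mem_eq_sup' Finset.univ_nonempty fun i => Y i ω
    have h1 : Real.exp (a * M ω) ≤ ∑ i, Real.exp (a * Y i ω) := by
      rw [show M ω = Y i ω from hi]
      exact Finset.single_le_sum (f := fun j => Real.exp (a * Y j ω))
        (fun j _ => (Real.exp_pos _).le) (Finset.mem_univ i)
    have h2 := Real.add_one_le_exp (a * M ω - Real.log A)
    rw [Real.exp_sub, Real.exp_log hA0, div_eq_inv_mul] at h2
    have h3 := mul_le_mul_of_nonneg_left h1 (inv_nonneg.2 hA0.le)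
    linarith
  have h := integral_mono (hMint.const_mul a)
    ((integrable_const (Real.log A - 1)).add (hsum_int.const_mul A⁻¹)) hpt
  simp only [Pi.add_apply] at h
  rw [integral_const_mul, integral_add (integrable_const _) (hsum_int.const_mul A⁻¹),
    integral_const_mul, hsum, inv_mul_cancel₀ hA0.ne', ← ha, hA,
    Real.log_mul hN0.ne' (Real.exp_pos _).ne', Real.log_exp] at h
  simp only [integral_const, probReal_univ, one_smul] at h
  rw [← Real.sqrt_mul (by norm_num)]
  refine Real.le_sqrt_of_sq_le ?_
  -- The integrated inequality reads `a² ≤ log N + a²/2`.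
  nlinarith

lemma le_integral_sup'_stdNormal (hlaw : ∀ i, HasLaw (Y i) (gaussianReal 0 1) μ)
    (hindep : iIndepFun Y μ) :
    0.3381 * √(Real.log (Fintype.card ι)) ≤
      ∫ ω, Finset.univ.sup' Finset.univ_nonempty (fun i => Y i ω) ∂μ := by
  have hint := integrable_sup'_stdNormal hlaw
  rcases lt_or_ge 16 (Fintype.card ι) with h16 | h16
  · obtain ⟨n, hn⟩ := Nat.exists_eq_succ_of_ne_zero (Fintype.card_ne_zero (α := ι))
    have h := integral_comp_sup'_stdNormal hlaw hindep hn continuous_id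
    simp only [id] at h
    rw [h, hn]
    exact sqrt_log_le_integral_mul_maxNormalPDF (by omega)
  -- A single variable has mean 0 and `log 1 = 0`; otherwise the maximum dominates that of two of
  -- the variables.
  rcases Nat.lt_or_ge (Fintype.card ι) 2 with h2 | h2
  · have h1 : Fintype.card ι = 1 := le_antisymm (by omega) Fintype.card_pos
    obtain ⟨i⟩ := ‹Nonempty ι›
    have h := integral_mono ((memLp_of_hasLaw_gaussianReal (hlaw i) 1).integrable (by simp)) hint
      fun ω => Finset.le_sup' (fun i => Y i ω) (Finset.mem_univ i)
    rw [(hlaw i).integral_eq, integral_id_gaussianReal] at h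
    simpa [h1] using h
  · obtain ⟨e⟩ := Function.Embedding.nonempty_of_card_le (α := Fin 2) (β := ι) (by simpa using h2)
    refine (sqrt_log_le_inv_sqrt_pi Fintype.card_pos h16).trans ?_
    have h := integral_comp_sup'_stdNormal (fun j => hlaw (e j)) (hindep.precomp e.injective)
      (n := 1) (by simp) continuous_id
    simp only [id] at h
    rw [← integral_mul_maxNormalPDF_one, ← h]
    exact integral_mono (integrable_sup'_stdNormal fun j => hlaw (e j)) hint fun ω =>
      Finset.sup'_le _ _ fun j _ => Finset.le_sup' (fun i => Y i ω) (Finset.mem_univ (e j))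

end Maximum

theorem theorem2 {Ω : Type*} [MeasurableSpace Ω] (μ : Measure Ω) [IsProbabilityMeasure μ]
    (N K : ℕ) [NeZero N] (b ε Δt : ℝ) (hb : 0 < b) (hε : 0 < ε) (hΔt : 0 < Δt)
    (w : Fin N → Fin K → Ω → ℝ) (hw : ∀ i k, Measurable (w i k))
    -- the noise trajectories of different customers are independent
    (hindep : iIndepFun (fun (i : Fin N) (ω : Ω) (k : Fin K) => w i k ω) μ)
    -- every billing error is Gaussian
    (hgauss : ∀ i, HasLaw (billingError Δt w i)
      (gaussianReal 0 (2 * K * (b ^ 2 / ε ^ 2) * Δt ^ 2).toNNReal) μ) :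
    MemLp (maxBillingError Δt w) 2 μ ∧
    0.478 * (b / ε) * Δt * √K * √(Real.log N) ≤ ∫ ω, maxBillingError Δt w ω ∂μ ∧
    ∫ ω, maxBillingError Δt w ω ∂μ ≤ 2 * (b / ε) * Δt * √K * √(Real.log N) ∧
    variance (maxBillingError Δt w) μ ≤ 8 * K * (b ^ 2 / ε ^ 2) * Δt ^ 2 := by
  refine ⟨memLp_sup'_univ fun i => memLp_of_hasLaw_gaussianReal (hgauss i) 2, ?_⟩
  -- For `K = 0` every error vanishes, and `σ` would be 0.
  rcases Nat.eq_zero_or_pos K with rfl | hK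
  · have h0 : maxBillingError Δt w = 0 := by
      ext ω
      simp [maxBillingError, billingError]
    simp [h0]
  have hK' : (0 : ℝ) < K := by exact_mod_cast hK
  set σ := √2 * (b / ε) * Δt * √K with hσ
  have hσ0 : 0 < σ := by positivity
  have hσsq : σ ^ 2 = 2 * K * (b ^ 2 / ε ^ 2) * Δt ^ 2 := by
    rw [hσ, mul_pow, mul_pow, mul_pow, Real.sq_sqrt hK'.le, Real.sq_sqrt (by norm_num)]
    ring
  set Y : Fin N → Ω → ℝ := fun i ω => billingError Δt w i ω / σ with hY
  have hlaw : ∀ i, HasLaw (Y i) (gaussianReal 0 1) μ := fun i => by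
    convert! gaussianReal_div_const (hgauss i) σ using 1
    rw [← hσsq]
    congr 1
    · simp
    · ext
      simp [Real.coe_toNNReal _ (sq_nonneg σ), hσ0.ne']
  have hindepY : iIndepFun Y μ :=
    hindep.comp (fun _ x => (Δt * ∑ k, x k) / σ) fun _ => by fun_prop
  have hM : ∀ ω, maxBillingError Δt w ω =
      σ * Finset.univ.sup' Finset.univ_nonempty fun i => Y i ω := fun ω => by
    have h := Finset.apply_sup'_eq_sup'_comp (s := Finset.univ) Finset.univ_nonempty
      (f := fun i => Y i ω) (fun x => σ * x) fun x y => (mul_max_of_nonneg x y hσ0.le)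
    simp only [maxBillingError]
    rw [h]
    congr 1
    ext i
    simp only [Function.comp, hY]
    field_simp
  have hlow := le_integral_sup'_stdNormal hlaw hindepY
  have hup := integral_sup'_stdNormal_le hlaw
  have hvar := variance_sup'_stdNormal_le_one hlaw hindepY
  rw [Fintype.card_fin] at hlow hup
  have hs2 : 1.4142 ≤ √2 := Real.le_sqrt_of_sq_le (by norm_num)
  rw [show maxBillingError Δt w = _ from funext hM, integral_const_mul, variance_const_mul, hσsq]
  refine ⟨?_, ?_, ?_⟩
  · refine le_trans ?_ (mul_le_mul_of_nonneg_left hlow hσ0.le)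
    -- This is where 0.3381 comes from: it slightly exceeds `0.478 / √2`.
    have h : 0.478 ≤ √2 * 0.3381 := by linarith
    calc 0.478 * (b / ε) * Δt * √K * √(Real.log N)
        ≤ (√2 * 0.3381) * (b / ε) * Δt * √K * √(Real.log N) := by gcongr
      _ = _ := by rw [hσ]; ring
  · refine (mul_le_mul_of_nonneg_left hup hσ0.le).trans_eq ?_
    rw [hσ]
    linear_combination ((b / ε) * Δt * √K * √(Real.log N)) *
      Real.mul_self_sqrt (show (0 : ℝ) ≤ 2 by norm_num)
  -- The variance is in fact at most `σ²`, a quarter of the stated bound.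
  · have h0 : 0 ≤ 2 * K * (b ^ 2 / ε ^ 2) * Δt ^ 2 := by positivity
    have h1 := mul_le_mul_of_nonneg_left hvar h0
    linarith
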